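/- Let $G=(V\sqcup W,E)$ be a finite bipartite graph with color classes $V$ and $W$. For a finite bipartite graph $H$ with vertex set $U\neq\emptyset$, let $Q_H\subset\mathbb{R}^{U}$ be its root polytope, i.e. the convex hull of the vectors $\mathbf{v}+\mathbf{w}$ over all edges $vw$ of $H$ (where $\mathbf{u}$ denotes the standard basis vector of $u\in U$), and let $$\mathrm{Ehr}_{Q_H}(x)=1+\sum_{s\ge 1}\bigl|(s\cdot Q_H)\cap\mathbb{Z}^{U}\bigr|\,x^s .$$ The interior polynomial $I_H(x)$ is the polynomial with integer coefficients defined by $$\frac{I_H(x)}{(1-x)^{|U|-1}}=\mathrm{Ehr}_{Q_H}(x).$$ Suppose that $V\neq\emptyset$, that every vertex of $V$ has at least one neighbor in $W$, and that $|V|\ge |W|$. Then the interior polynomials of $G$ and of $G-J$ for every $J\subseteq V$ exist, and $$I_G(x)=\sum_{\emptyset\neq J\subseteq V}(-1)^{|J|-1}I_{G-J}(x),$$ where $G-J$ is the bipartite graph obtained from $G$ by deleting all vertices in $J$ and all edges incident to them. -/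

import Mathlib

open scoped Polynomial PowerSeries Pointwise

noncomputable section

open Classical in
/-- The root polytope of a (bipartite) graph: the convex hull in `ℝ^U` of the vectors
`e_a + e_b`, where `ab` runs over the edges. When `U = V ⊔ W` this is a polytope in
`ℝ^V ⊕ ℝ^W`. -/
def rootPolytope {U : Type*} (G : SimpleGraph U) : Set (U → ℝ) :=
  convexHull ℝ {p | ∃ a b, G.Adj a b ∧ p = Pi.single a 1 + Pi.single b 1}

/-- The number of lattice points in the `s`-fold dilation of the root polytope. For finite `U`
the set is finite, because the root polytope is bounded. -/
def ehrhartCount {U : Type*} (G : SimpleGraph U) (s : ℕ) : ℕ :=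
  Set.ncard {z : U → ℤ | (fun u => (z u : ℝ)) ∈ (s : ℝ) • rootPolytope G}

/-- The Ehrhart series `1 + ∑_{s ≥ 1} ε(s) x^s` of the root polytope. -/
def ehrhartSeries {U : Type*} (G : SimpleGraph U) : ℤ⟦X⟧ :=
  PowerSeries.mk fun s => if s = 0 then 1 else (ehrhartCount G s : ℤ)

/-- `P` is the interior polynomial of the graph `G`, which has at least one vertex:
`P / (1 - x)^(|U| - 1)` is the Ehrhart series of the root polytope. As `1 - x` is invertible
among power series, this is written without division. There is at most one such `P`. -/
def IsInteriorPolynomial {U : Type*} (G : SimpleGraph U) (P : ℤ[X]) : Prop :=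
  (P : ℤ⟦X⟧) = (1 - PowerSeries.X) ^ (Nat.card U - 1) * ehrhartSeries G

open Classical in
/-- The interior polynomial of `G`: the unique polynomial with `IsInteriorPolynomial G`. -/
def interiorPolynomial {U : Type*} (G : SimpleGraph U) : ℤ[X] :=
  if h : ∃ P : ℤ[X], IsInteriorPolynomial G P then h.choose else 0

/-- The graph `G - J`: delete the vertices in `J` and all edges incident to them. -/
abbrev deleteVertices {U : Type*} (G : SimpleGraph U) (J : Finset U) :
    SimpleGraph ((J : Set U)ᶜ : Set U) :=
  G.induce ((J : Set U)ᶜ)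

end

/-!
Let `p(a)`, for `a ∈ ℕ^V`, be the number of `b ∈ ℤ^W` such that `(a, b)` is a lattice point of
`|a| • Q_G`. Deleting the vertices in `J ⊆ V` cuts out the face of the root polytope on which the
coordinates in `J` vanish, so the Ehrhart series of `G - J` is the sum of `p(a) x^|a|` over the
`a ∈ ℕ^V` that vanish on `J` (`ehrhartSeries_comap`).

The theorem holds because `p` is a polynomial function of degree at most `|W| - 1`, less than
`|V|`. For such functions, `(1 - x) ∑_a p(a) x^|a|` is the sum over the face `a v = 0` plus `x`
times the generating function of the difference of `p` in direction `v` (`one_sub_X_mul_genFun`).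
Using this in one direction after another shows that the generating function over `ℕ^A` has
denominator `(1 - x)^(|A| + |W| - 1)` (`exists_polynomial_eq_genFun`), so that the interior
polynomials exist. Using it once in every direction of `V` shows that the alternating sum of
`(1 - x)^(|V| - |J|) Ehr_{G-J}` equals `x^|V|` times the generating function of the mixed
difference of `p` in all directions of `V`, which is zero (`alternating_sum_genFun_eq_zero`).

To see that `p` is polynomial, write `N v` for the set of neighbours of `v`. By Hall's theorem,
`p(a)` counts the integer points `b` of the base polytope of the supermodular function
`f_a(R) = ∑_{N v ⊆ R} a v` on subsets `R` of `W`. When `a v` increases by one, the new bases, up to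
translation by the unit vector of some `w ∈ N v`, are those for which the smallest tight set `S`
containing `w` does not contain `N v` (`ncard_bases_increment`). A base with smallest tight set `S`
is a base on `S` with no smaller tight set containing `w`, together with a base of the contraction
on `W \ S` (`ncard_minTight`). By induction on the ground set, these products have degree at most
`(|S| - 1) + (|W \ S| - 1) = |W| - 2`, hence `p` has degree at most `|W| - 1`
(`degreeLT_ncard_bases`).
-/

/-! ### Functions with vanishing iterated differences -/

/-- `DegreeLT n p` says that all `n`-fold forward differences of `p : ℕ^ι → ℤ` in coordinate
directions vanish, i.e. that `p` is a polynomial function of total degree less than `n`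
(`p = 0` if `n = 0`). -/
def DegreeLT {ι : Type*} [DecidableEq ι] : ℕ → ((ι → ℕ) → ℤ) → Prop
  | 0, p => p = 0
  | n + 1, p => ∀ v, DegreeLT n (fwdDiff (Pi.single v 1) p)

namespace DegreeLT

variable {ι : Type*} [DecidableEq ι] {p q : (ι → ℕ) → ℤ} {m n : ℕ}

lemma zero : ∀ n, DegreeLT n (0 : (ι → ℕ) → ℤ)
  | 0 => rfl
  | n + 1 => fun v => by
    have : fwdDiff (Pi.single v 1) (0 : (ι → ℕ) → ℤ) = 0 := by ext; simp [fwdDiff]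
    rw [this]; exact zero n

lemma succ : ∀ {n : ℕ} {p : (ι → ℕ) → ℤ}, DegreeLT n p → DegreeLT (n + 1) p
  | 0, p, h => by rw [show p = 0 from h]; exact zero _
  | _ + 1, _, h => fun v => succ (h v)

lemma mono (h : DegreeLT m p) (hmn : m ≤ n) : DegreeLT n p := by
  induction hmn with
  | refl => exact h
  | step _ ih => exact ih.succ

lemma add : ∀ {n : ℕ} {p q : (ι → ℕ) → ℤ}, DegreeLT n p → DegreeLT n q → DegreeLT n (p + q)
  | 0, p, q, hp, hq => by
    rw [show p = 0 from hp, show q = 0 from hq, add_zero]; exact zero 0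
  | n + 1, p, q, hp, hq => fun v => by
    rw [fwdDiff_add]; exact add (hp v) (hq v)

lemma neg : ∀ {n : ℕ} {p : (ι → ℕ) → ℤ}, DegreeLT n p → DegreeLT n (-p)
  | 0, p, hp => by rw [show p = 0 from hp, neg_zero]; exact zero 0
  | n + 1, p, hp => fun v => by
    have : fwdDiff (Pi.single v 1) (-p) = -fwdDiff (Pi.single v 1) p := by
      ext; simp [fwdDiff]; ring
    rw [this]; exact neg (hp v)

lemma sub (hp : DegreeLT n p) (hq : DegreeLT n q) : DegreeLT n (p - q) := by
  rw [sub_eq_add_neg]; exact hp.add hq.neg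

lemma sum {κ : Type*} (s : Finset κ) (f : κ → (ι → ℕ) → ℤ) (h : ∀ k ∈ s, DegreeLT n (f k)) :
    DegreeLT n (∑ k ∈ s, f k) :=
  Finset.sum_induction f (DegreeLT n) (fun _ _ => add) (zero n) h

lemma shift (c : ι → ℕ) : ∀ {n : ℕ} {p : (ι → ℕ) → ℤ}, DegreeLT n p →
    DegreeLT n (fun a => p (a + c))
  | 0, p, hp => by rw [show p = 0 from hp]; rfl
  | n + 1, p, hp => fun v => by
    have : fwdDiff (Pi.single v 1) (fun a => p (a + c)) =
        fun a => fwdDiff (Pi.single v 1) p (a + c) := by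
      ext a; simp [fwdDiff, add_right_comm]
    rw [this]; exact shift c (hp v)

/-- Degrees add up: if `deg p ≤ m` and `deg q ≤ n` then `deg (p * q) ≤ m + n`. -/
lemma mul : ∀ {k m n : ℕ} {p q : (ι → ℕ) → ℤ}, m + n = k →
    DegreeLT (m + 1) p → DegreeLT (n + 1) q → DegreeLT (k + 1) (p * q) := by
  intro k
  induction k with
  | zero =>
    intro m n p q hk hp hq v
    obtain ⟨rfl, rfl⟩ : m = 0 ∧ n = 0 := by omega
    have hp' : fwdDiff (Pi.single v 1) p = 0 := hp v
    have hq' : fwdDiff (Pi.single v 1) q = 0 := hq v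
    ext a
    have h1 := congrFun hp' a
    have h2 := congrFun hq' a
    simp only [fwdDiff, Pi.zero_apply, sub_eq_zero] at h1 h2
    simp [fwdDiff, h1, h2]
  | succ k ih =>
    intro m n p q hk hp hq v
    -- the product rule for forward differences
    have key : fwdDiff (Pi.single v 1) (p * q) =
        fwdDiff (Pi.single v 1) p * (fun a => q (a + Pi.single v 1)) +
          p * fwdDiff (Pi.single v 1) q := by
      ext a; simp [fwdDiff]; ring
    rw [key]
    refine add ?_ ?_
    · rcases m with _ | m
      · rw [show fwdDiff (Pi.single v 1) p = 0 from hp v, zero_mul]; exact zero _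
      · exact ih (by omega) (hp v) (hq.shift _)
    · rcases n with _ | n
      · rw [show fwdDiff (Pi.single v 1) q = 0 from hq v, mul_zero]; exact zero _
      · exact ih (by omega) hp (hq v)

end DegreeLT

/-! ### Generating functions of such functions -/

section GeneratingFunction

variable {ι : Type*} [DecidableEq ι]

/-- The generating function `∑ p(a) x^|a|` over all `a : ι → ℕ` supported in `A`, where `|a|` is
the sum of the entries of `a`. -/
noncomputable def genFun (A : Finset ι) (p : (ι → ℕ) → ℤ) : ℤ⟦X⟧ :=
  PowerSeries.mk fun s => ∑ a ∈ A.piAntidiag s, p a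

lemma genFun_zero (A : Finset ι) : genFun A 0 = 0 := by
  ext s; simp [genFun]

lemma genFun_empty (p : (ι → ℕ) → ℤ) : genFun ∅ p = (Polynomial.C (p 0) : ℤ[X]) := by
  ext s
  rw [Polynomial.coeff_coe, Polynomial.coeff_C]
  rcases s with _ | s <;> simp [genFun]

/-- Split the multi-indices according to whether their entry at `v` vanishes. -/
lemma sum_piAntidiag_succ (A : Finset ι) {v : ι} (hv : v ∈ A) (p : (ι → ℕ) → ℤ) (s : ℕ) :
    ∑ a ∈ A.piAntidiag (s + 1), p a =
      ∑ a ∈ (A.erase v).piAntidiag (s + 1), p a +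
        ∑ a ∈ A.piAntidiag s, p (a + Pi.single v 1) := by
  rw [← Finset.sum_filter_add_sum_filter_not _ (fun a => a v = 0)]
  congr 1
  · refine Finset.sum_congr ?_ fun _ _ => rfl
    ext a
    simp only [Finset.mem_filter, Finset.mem_piAntidiag, Finset.mem_erase]
    constructor
    · rintro ⟨⟨hs, ha⟩, h0⟩
      refine ⟨?_, fun i hi => ⟨fun h => hi (h ▸ h0), ha i hi⟩⟩
      rw [← hs, ← Finset.add_sum_erase _ _ hv, h0, zero_add]
    · rintro ⟨hs, ha⟩
      have h0 : a v = 0 := by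
        by_contra h; exact (ha v h).1 rfl
      refine ⟨⟨?_, fun i hi => (ha i hi).2⟩, h0⟩
      rw [← hs, ← Finset.add_sum_erase _ _ hv, h0, zero_add]
  · symm
    refine Finset.sum_bij' (fun a _ => a + Pi.single v 1) (fun a _ => a - Pi.single v 1)
      ?_ ?_ ?_ ?_ fun _ _ => rfl
    · intro a ha
      simp only [Finset.mem_filter, Finset.mem_piAntidiag] at ha ⊢
      refine ⟨⟨?_, fun i hi => ?_⟩, by simp⟩
      · simp [Finset.sum_add_distrib, ha.1, hv]
      · by_cases hiv : i = v
        · exact hiv ▸ hv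
        · exact ha.2 i (by simpa [hiv] using hi)
    · intro a ha
      simp only [Finset.mem_filter, Finset.mem_piAntidiag] at ha ⊢
      refine ⟨?_, fun i hi => ha.1.2 i ?_⟩
      · have h1 := Finset.add_sum_erase A a hv
        have h2 := Finset.add_sum_erase A (a - Pi.single v 1) hv
        have h3 : ∑ i ∈ A.erase v, (a - Pi.single v 1 : ι → ℕ) i = ∑ i ∈ A.erase v, a i :=
          Finset.sum_congr rfl fun i hi => by simp [Finset.ne_of_mem_erase hi]
        have h4 : (a - Pi.single v 1 : ι → ℕ) v = a v - 1 := by simp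
        have h5 : ∑ i ∈ A, a i = s + 1 := ha.1.1
        have h6 := ha.2
        change ∑ i ∈ A, (a - Pi.single v 1 : ι → ℕ) i = s
        omega
      · intro h; apply hi; simp [h]
    · intro a _
      ext i; simp
    · intro a ha
      simp only [Finset.mem_filter] at ha
      ext i
      by_cases hiv : i = v
      · subst hiv; simp; omega
      · simp [hiv]

lemma one_sub_X_mul_genFun (A : Finset ι) {v : ι} (hv : v ∈ A) (p : (ι → ℕ) → ℤ) :
    (1 - PowerSeries.X) * genFun A p =
      genFun (A.erase v) p + PowerSeries.X * genFun A (fwdDiff (Pi.single v 1) p) := by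
  ext s
  rcases s with _ | s
  · simp [sub_mul, genFun]
  · simp only [sub_mul, one_mul, map_sub, map_add, PowerSeries.coeff_succ_X_mul]
    simp only [genFun, PowerSeries.coeff_mk, sum_piAntidiag_succ A hv, fwdDiff,
      Finset.sum_sub_distrib]
    ring

/-- The generating function of a polynomial function of degree at most `n` over `ℕ^A` is a
rational function with denominator `(1 - x)^(|A| + n)`. -/
lemma exists_polynomial_eq_genFun : ∀ (k n : ℕ) (A : Finset ι) (p : (ι → ℕ) → ℤ),
    A.card + n = k → DegreeLT (n + 1) p →
    ∃ P : ℤ[X], (P : ℤ⟦X⟧) = (1 - PowerSeries.X) ^ (A.card + n) * genFun A p := by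
  intro k
  induction k with
  | zero =>
    intro n A p hk _
    obtain ⟨hA, rfl⟩ : A.card = 0 ∧ n = 0 := by omega
    rw [Finset.card_eq_zero] at hA
    subst hA
    exact ⟨Polynomial.C (p 0), by rw [genFun_empty]; simp⟩
  | succ k ih =>
    intro n A p hk hp
    rcases A.eq_empty_or_nonempty with rfl | ⟨v, hv⟩
    · exact ⟨(1 - Polynomial.X) ^ n * Polynomial.C (p 0), by rw [genFun_empty]; simp⟩
    · have hc := Finset.card_erase_add_one hv
      obtain ⟨P, hP⟩ := ih n (A.erase v) p (by omega) hp
      obtain ⟨Q, hQ⟩ : ∃ Q : ℤ[X], (Q : ℤ⟦X⟧) = (1 - PowerSeries.X) ^ k *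
          genFun A (fwdDiff (Pi.single v 1) p) := by
        rcases n with _ | n
        · refine ⟨0, ?_⟩
          rw [show fwdDiff (Pi.single v 1) p = 0 from hp v, genFun_zero]; simp
        · obtain ⟨Q, hQ⟩ := ih n A _ (by omega) (hp v)
          exact ⟨Q, by rw [hQ]; congr 2; omega⟩
      refine ⟨P + Polynomial.X * Q, ?_⟩
      rw [hk, pow_succ, mul_assoc, one_sub_X_mul_genFun A hv, Polynomial.coe_add,
        Polynomial.coe_mul, Polynomial.coe_X, hP, hQ, show (A.erase v).card + n = k by omega]
      ring

/-- Each subset `B` of the coordinates gives an inclusion-exclusion identity for generating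
functions; its right-hand side involves the mixed difference of `p` in the directions `B`, which
vanishes when the degree of `p` is less than `|B|`. -/
lemma exists_alternating_sum_genFun (B : Finset ι) :
    ∀ (n : ℕ) (p : (ι → ℕ) → ℤ), DegreeLT (B.card + n) p →
    ∃ q : (ι → ℕ) → ℤ, DegreeLT n q ∧ ∀ A : Finset ι, B ⊆ A →
      ∑ J ∈ B.powerset, (-1) ^ J.card * (1 - PowerSeries.X) ^ (B.card - J.card) *
        genFun (A \ J) p = PowerSeries.X ^ B.card * genFun A q := by
  induction B using Finset.induction_on with
  | empty => intro n p hp; exact ⟨p, by simpa using hp, fun A _ => by simp⟩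
  | insert v B hv ih =>
    intro n p hp
    rw [Finset.card_insert_of_notMem hv] at hp ⊢
    obtain ⟨q, hq, h⟩ := ih (n + 1) p (by convert hp using 1; ring)
    refine ⟨_, hq v, fun A hA => ?_⟩
    obtain ⟨hvA, hBA⟩ := Finset.insert_subset_iff.1 hA
    have h1 := h A hBA
    have h2 := h (A.erase v) fun i hi =>
      Finset.mem_erase.2 ⟨fun e => hv (e ▸ hi), hBA hi⟩
    have h3 := one_sub_X_mul_genFun A hvA q
    rw [Finset.sum_powerset_insert hv]
    have e1 : ∑ J ∈ B.powerset, (-1) ^ J.card * (1 - PowerSeries.X) ^ (B.card + 1 - J.card) *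
        genFun (A \ J) p = (1 - PowerSeries.X) * ∑ J ∈ B.powerset,
          (-1) ^ J.card * (1 - PowerSeries.X) ^ (B.card - J.card) * genFun (A \ J) p := by
      rw [Finset.mul_sum]
      refine Finset.sum_congr rfl fun J hJ => ?_
      have := Finset.card_le_card (Finset.mem_powerset.1 hJ)
      rw [Nat.sub_add_comm this, pow_succ]; ring
    have e2 : ∑ J ∈ B.powerset, (-1) ^ (insert v J).card *
        (1 - PowerSeries.X) ^ (B.card + 1 - (insert v J).card) * genFun (A \ insert v J) p =
        -∑ J ∈ B.powerset, (-1) ^ J.card * (1 - PowerSeries.X) ^ (B.card - J.card) *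
          genFun (A.erase v \ J) p := by
      rw [← Finset.sum_neg_distrib]
      refine Finset.sum_congr rfl fun J hJ => ?_
      have hvJ : v ∉ J := fun h => hv (Finset.mem_powerset.1 hJ h)
      have hs : A \ insert v J = A.erase v \ J := by ext i; simp; tauto
      rw [Finset.card_insert_of_notMem hvJ, hs, Nat.add_sub_add_right, pow_succ]; ring
    rw [e1, e2, h1, h2, pow_succ]
    linear_combination PowerSeries.X ^ B.card * h3

/-- If `p` has degree less than `|V|`, the inclusion-exclusion sum over the faces of the orthant
`ℕ^V` vanishes. -/
lemma alternating_sum_genFun_eq_zero (V : Finset ι) (p : (ι → ℕ) → ℤ) (hp : DegreeLT V.card p) :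
    ∑ J ∈ V.powerset, (-1) ^ J.card * (1 - PowerSeries.X) ^ (V.card - J.card) *
      genFun (V \ J) p = 0 := by
  obtain ⟨q, hq, h⟩ := exists_alternating_sum_genFun V 0 p hp
  rw [h V subset_rfl, show q = 0 from hq, genFun_zero, mul_zero]

end GeneratingFunction

/-! ### Integer bases of supermodular functions -/

section Bases

variable {α : Type*} [DecidableEq α]

/-- The integer points of the base polytope of `f` on the ground set `T`: the vectors supported in
`T` whose sum over each `R ⊆ T` is at least `f R`, with equality for `R = T`. -/
def bases (f : Finset α → ℤ) (T : Finset α) : Set (α → ℤ) :=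
  {b | (∀ i ∉ T, b i = 0) ∧ (∀ R ⊆ T, f R ≤ ∑ i ∈ R, b i) ∧ ∑ i ∈ T, b i = f T}

/-- Supermodularity of a set function. -/
def IsSupermodular (f : Finset α → ℤ) : Prop :=
  ∀ R S, f R + f S ≤ f (R ∪ S) + f (R ∩ S)

/-- The contraction of a set function by `S`. -/
def contract (f : Finset α → ℤ) (S : Finset α) : Finset α → ℤ := fun R => f (R ∪ S) - f S

/-- The intersection of all tight sets `R ⊆ T` of `b` (those with `∑ i ∈ R, b i = f R`) that
contain `w`. -/
def minTight (f : Finset α → ℤ) (w : α) (T : Finset α) (b : α → ℤ) : Finset α :=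
  {i ∈ T | ∀ R ⊆ T, w ∈ R → ∑ j ∈ R, b j = f R → i ∈ R}

/-- The bases on `T` for which no proper subset of `T` that contains `w` is tight. -/
def criticalBases (f : Finset α → ℤ) (w : α) (T : Finset α) : Set (α → ℤ) :=
  {b ∈ bases f T | ∀ R ⊂ T, w ∈ R → f R < ∑ i ∈ R, b i}

variable {f : Finset α → ℤ} {S T : Finset α} {w : α} {b : α → ℤ}

lemma bases_finite [Fintype α] (f : Finset α → ℤ) (T : Finset α) : (bases f T).Finite := by
  refine (Set.finite_Icc (fun i => if i ∈ T then f {i} else 0)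
    (fun i => if i ∈ T then f T - f (T.erase i) else 0)).subset ?_
  rintro b ⟨h0, hle, hT⟩
  refine ⟨fun i => ?_, fun i => ?_⟩
  · by_cases hi : i ∈ T
    · simpa [hi] using hle {i} (by simpa using hi)
    · simp [hi, h0]
  · by_cases hi : i ∈ T
    · have h1 := hle _ (Finset.erase_subset i T)
      have h2 := Finset.add_sum_erase T b hi
      simp only [hi, if_true]
      omega
    · simp [hi, h0]

/-- Tight sets of a base are closed under intersection. -/
lemma tight_inter (hf : IsSupermodular f) (hb : b ∈ bases f T) {R S : Finset α} (hR : R ⊆ T)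
    (hS : S ⊆ T) (hR' : ∑ i ∈ R, b i = f R) (hS' : ∑ i ∈ S, b i = f S) :
    ∑ i ∈ R ∩ S, b i = f (R ∩ S) := by
  have h1 := Finset.sum_union_inter (s₁ := R) (s₂ := S) (f := b)
  have h2 := hf R S
  have h3 := hb.2.1 _ (Finset.union_subset hR hS)
  have h4 := hb.2.1 (R ∩ S) (Finset.inter_subset_left.trans hR)
  omega

lemma minTight_subset : minTight f w T b ⊆ T := Finset.filter_subset _ _

lemma minTight_subset_of_tight {R : Finset α} (hR : R ⊆ T) (hw : w ∈ R)
    (h : ∑ i ∈ R, b i = f R) : minTight f w T b ⊆ R :=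
  fun _ hi => (Finset.mem_filter.1 hi).2 R hR hw h

lemma mem_minTight (hw : w ∈ T) : w ∈ minTight f w T b :=
  Finset.mem_filter.2 ⟨hw, fun _ _ h _ => h⟩

lemma minTight_tight (hf : IsSupermodular f) (hb : b ∈ bases f T) (hw : w ∈ T) :
    ∑ i ∈ minTight f w T b, b i = f (minTight f w T b) := by
  have hne : (T.powerset.filter fun R => w ∈ R ∧ ∑ i ∈ R, b i = f R).Nonempty :=
    ⟨T, by simp [hw, hb.2.2]⟩
  obtain ⟨R, hR, hmin⟩ := Finset.exists_min_image _ Finset.card hne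
  simp only [Finset.mem_filter, Finset.mem_powerset] at hR hmin
  -- a tight set of minimal size is contained in every other tight set
  have : minTight f w T b = R := by
    refine (minTight_subset_of_tight hR.1 hR.2.1 hR.2.2).antisymm fun i hi => ?_
    refine Finset.mem_filter.2 ⟨hR.1 hi, fun Q hQ hwQ hQt => ?_⟩
    have h1 := hmin (R ∩ Q) ⟨Finset.inter_subset_left.trans hR.1, by simp [hR.2.1, hwQ],
      tight_inter hf hb hR.1 hQ hR.2.2 hQt⟩
    have h2 := Finset.eq_of_subset_of_card_le Finset.inter_subset_left h1
    rw [← h2] at hi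
    exact (Finset.mem_inter.1 hi).2
  rw [this, hR.2.2]

/-- A base whose minimal tight set is `S` is the sum of a critical base on `S` and a base of the
contraction by `S`. -/
lemma setOf_minTight_eq_image (hf : IsSupermodular f) (hS : S ⊆ T) (hw : w ∈ S) :
    {b ∈ bases f T | minTight f w T b = S} =
      (fun c : (α → ℤ) × (α → ℤ) => c.1 + c.2) ''
        (criticalBases f w S ×ˢ bases (contract f S) (T \ S)) := by
  ext b
  constructor
  · rintro ⟨hb, hm⟩
    have ht : ∑ i ∈ S, b i = f S := hm ▸ minTight_tight hf hb (hS hw)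
    have hc : ∀ R ⊆ S, ∑ i ∈ R, (if i ∈ S then b i else 0) = ∑ i ∈ R, b i := fun R hR =>
      Finset.sum_congr rfl fun i hi => by simp [hR hi]
    have hd : ∀ R ⊆ T \ S, ∑ i ∈ R, (if i ∈ S then 0 else b i) =
        ∑ i ∈ R ∪ S, b i - ∑ i ∈ S, b i := fun R hR => by
      have hdisj : Disjoint R S := Finset.disjoint_of_subset_left hR Finset.sdiff_disjoint
      rw [Finset.sum_union hdisj, add_sub_cancel_right]
      exact Finset.sum_congr rfl fun i hi => by
        simp [(Finset.mem_sdiff.1 (hR hi)).2]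
    refine ⟨(fun i => if i ∈ S then b i else 0, fun i => if i ∈ S then 0 else b i),
      ⟨⟨⟨fun i hi => by simp [hi], fun R hR => ?_, ?_⟩, fun R hR hwR => ?_⟩,
        fun i hi => ?_, fun R hR => ?_, ?_⟩, ?_⟩
    · rw [hc R hR]; exact hb.2.1 R (hR.trans hS)
    · rw [hc S subset_rfl, ht]
    · rw [hc R hR.1]
      refine lt_of_le_of_ne (hb.2.1 R (hR.1.trans hS)) fun h => hR.2 ?_
      rw [← hm]
      exact minTight_subset_of_tight (hR.1.trans hS) hwR h.symm
    · by_cases hi' : i ∈ S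
      · simp [hi']
      · simp only [hi', if_false]
        exact hb.1 i fun h => hi (Finset.mem_sdiff.2 ⟨h, hi'⟩)
    · rw [hd R hR, ht]
      exact sub_le_sub_right
        (hb.2.1 _ (Finset.union_subset (hR.trans Finset.sdiff_subset) hS)) _
    · rw [hd _ subset_rfl, ht, contract, Finset.sdiff_union_of_subset hS, hb.2.2]
    · ext i
      by_cases hi : i ∈ S <;> simp [hi]
  · rintro ⟨⟨c, d⟩, ⟨⟨hc, hcrit⟩, hd⟩, rfl⟩
    dsimp only at hc hcrit hd
    have hsum : ∀ R, ∑ i ∈ R, (c + d) i = ∑ i ∈ R ∩ S, c i + ∑ i ∈ R \ S, d i := fun R => by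
      simp only [Pi.add_apply]
      rw [Finset.sum_add_distrib]
      congr 1
      · exact (Finset.sum_subset Finset.inter_subset_left fun i hi hi' =>
          hc.1 i fun h => hi' (Finset.mem_inter.2 ⟨hi, h⟩)).symm
      · exact (Finset.sum_subset Finset.sdiff_subset fun i hi hi' =>
          hd.1 i fun h => hi' (Finset.mem_sdiff.2 ⟨hi, (Finset.mem_sdiff.1 h).2⟩)).symm
    have hb : c + d ∈ bases f T := by
      refine ⟨fun i hi => ?_, fun R hR => ?_, ?_⟩
      · rw [Pi.add_apply, hc.1 i fun h => hi (hS h),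
          hd.1 i fun h => hi (Finset.mem_sdiff.1 h).1, add_zero]
      · rw [hsum]
        have h1 := hc.2.1 (R ∩ S) Finset.inter_subset_right
        have h2 := hd.2.1 (R \ S) (Finset.sdiff_subset_sdiff hR subset_rfl)
        have h3 := hf R S
        rw [contract, Finset.sdiff_union_self_eq_union] at h2
        omega
      · rw [hsum, Finset.inter_eq_right.2 hS, hc.2.2, hd.2.2, contract,
          Finset.sdiff_union_of_subset hS]
        ring
    have ht : ∑ i ∈ S, (c + d) i = f S := by rw [hsum]; simp [hc.2.2]
    refine ⟨hb, (minTight_subset_of_tight hS hw ht).antisymm ?_⟩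
    have hmS := minTight_subset_of_tight (f := f) (b := c + d) hS hw ht
    have htm := minTight_tight hf hb (hS hw)
    by_contra hne
    have h := hcrit _ ⟨hmS, hne⟩ (mem_minTight (hS hw))
    simp only [hsum, Finset.inter_eq_left.2 hmS, Finset.sdiff_eq_empty_iff_subset.2 hmS,
      Finset.sum_empty, add_zero] at htm
    omega

lemma ncard_minTight (hf : IsSupermodular f) (hS : S ⊆ T) (hw : w ∈ S) :
    {b ∈ bases f T | minTight f w T b = S}.ncard =
      (criticalBases f w S).ncard * (bases (contract f S) (T \ S)).ncard := by
  rw [setOf_minTight_eq_image hf hS hw, Set.InjOn.ncard_image, Set.ncard_prod]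
  rintro ⟨c, d⟩ ⟨hc, hd⟩ ⟨c', d'⟩ ⟨hc', hd'⟩ h
  dsimp only at hc hd hc' hd'
  have hi : ∀ i, c i = c' i ∧ d i = d' i := fun i => by
    have h1 : c i + d i = c' i + d' i := congrFun h i
    by_cases hi : i ∈ S
    · have hi' : i ∉ T \ S := by simp [hi]
      have h2 := hd.1 i hi'
      have h3 := hd'.1 i hi'
      omega
    · have h2 := hc.1.1 i hi
      have h3 := hc'.1.1 i hi
      omega
  exact Prod.ext (funext fun i => (hi i).1) (funext fun i => (hi i).2)

variable [Fintype α]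

/-- Classify the bases by their minimal tight set. -/
lemma ncard_setOf_minTight (hf : IsSupermodular f) (hw : w ∈ T) (P : Finset α → Prop)
    [DecidablePred P] :
    {b ∈ bases f T | P (minTight f w T b)}.ncard =
      ∑ S ∈ T.powerset with w ∈ S ∧ P S,
        (criticalBases f w S).ncard * (bases (contract f S) (T \ S)).ncard := by
  have hfin : {b ∈ bases f T | P (minTight f w T b)}.Finite :=
    (bases_finite f T).subset (Set.sep_subset _ _)
  rw [Set.ncard_eq_toFinset_card _ hfin, Finset.card_eq_sum_card_fiberwise
    (f := minTight f w T) (t := {S ∈ T.powerset | w ∈ S ∧ P S})]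
  · refine Finset.sum_congr rfl fun S hS => ?_
    simp only [Finset.mem_filter, Finset.mem_powerset] at hS
    rw [← ncard_minTight hf hS.1 hS.2.1, ← Set.ncard_coe_finset]
    congr 1
    ext b
    simp only [Finset.coe_filter, Set.Finite.mem_toFinset, Set.mem_ofPred_eq]
    constructor
    · rintro ⟨⟨h1, _⟩, h2⟩; exact ⟨h1, h2⟩
    · rintro ⟨h1, h2⟩; exact ⟨⟨h1, h2 ▸ hS.2.2⟩, h2⟩
  · intro b hb
    simp only [Set.Finite.coe_toFinset, Set.mem_ofPred_eq] at hb
    simp [minTight_subset, mem_minTight hw, hb.2]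

lemma ncard_bases_eq_sum (hf : IsSupermodular f) (hw : w ∈ T) :
    (bases f T).ncard = ∑ S ∈ T.powerset with w ∈ S,
      (criticalBases f w S).ncard * (bases (contract f S) (T \ S)).ncard := by
  simpa using ncard_setOf_minTight hf hw fun _ => True

lemma ncard_bases_contract_self : (bases (contract f T) (T \ T)).ncard = 1 := by
  rw [Set.ncard_eq_one]
  refine ⟨0, Set.eq_singleton_iff_unique_mem.2 ⟨⟨by simp, fun R hR => ?_, by simp [contract]⟩,
    fun b hb => funext fun i => hb.1 i (by simp)⟩⟩
  rw [Finset.sdiff_self, Finset.subset_empty] at hR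
  simp [hR, contract]

/-- Raising `f` by one on all supersets of `K` creates new bases. After translating the old ones
by the unit vector of a point `w ∈ K`, the new ones are those whose minimal tight set containing
`w` does not contain `K`. -/
lemma ncard_bases_increment {f' : Finset α → ℤ} {K : Finset α} (hf' : IsSupermodular f')
    (hK : K ⊆ T) (hw : w ∈ K) (hff' : ∀ R, f' R = f R + if K ⊆ R then 1 else 0) :
    (bases f' T).ncard = (bases f T).ncard + ∑ S ∈ T.powerset with w ∈ S ∧ ¬ K ⊆ S,
      (criticalBases f' w S).ncard * (bases (contract f' S) (T \ S)).ncard := by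
  rw [← ncard_setOf_minTight hf' (hK hw)]
  have hsum : ∀ (R : Finset α) (b : α → ℤ), ∑ i ∈ R, (b + Pi.single w 1 : α → ℤ) i =
      ∑ i ∈ R, b i + if w ∈ R then 1 else 0 := fun R b => by
    simp [Finset.sum_add_distrib]
  have himg : (fun b : α → ℤ => b + Pi.single w 1) '' bases f T =
      {b ∈ bases f' T | K ⊆ minTight f' w T b} := by
    ext b
    constructor
    · rintro ⟨b, hb, rfl⟩
      refine ⟨⟨fun i hi => ?_, fun R hR => ?_, ?_⟩, fun i hi => ?_⟩
      · have : i ≠ w := fun h => hi (h ▸ hK hw)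
        simp [hb.1 i hi, this]
      · rw [hsum, hff']
        have h1 := hb.2.1 R hR
        by_cases hKR : K ⊆ R
        · simp [hKR, hKR hw, h1]
        · simp only [hKR, if_false]
          split_ifs <;> omega
      · rw [hsum, hff', hb.2.2]; simp [hK, hK hw]
      · refine Finset.mem_filter.2 ⟨hK hi, fun R hR hwR ht => ?_⟩
        rw [hsum, hff'] at ht
        have h1 := hb.2.1 R hR
        by_contra hiR
        have hKR : ¬ K ⊆ R := fun h => hiR (h hi)
        simp only [hwR, hKR, if_true, if_false] at ht
        omega
    · rintro ⟨hb, hmin⟩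
      have hback : b - Pi.single w 1 + Pi.single w 1 = b := sub_add_cancel _ _
      have hsum' : ∀ R : Finset α, ∑ i ∈ R, (b - Pi.single w 1 : α → ℤ) i =
          ∑ i ∈ R, b i - if w ∈ R then 1 else 0 := fun R => by
        have := hsum R (b - Pi.single w 1)
        rw [hback] at this; omega
      refine ⟨b - Pi.single w 1, ⟨fun i hi => ?_, fun R hR => ?_, ?_⟩, hback⟩
      · have : i ≠ w := fun h => hi (h ▸ hK hw)
        simp [hb.1 i hi, this]
      · rw [hsum']
        have h1 := hb.2.1 R hR
        have h2 := hff' R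
        by_cases hwR : w ∈ R
        · by_cases hKR : K ⊆ R
          · simp only [hwR, hKR, if_true] at h2 ⊢; omega
          · have h3 : ∑ i ∈ R, b i ≠ f' R := fun h =>
              hKR (hmin.trans (minTight_subset_of_tight hR hwR h))
            simp only [hwR, hKR, if_true, if_false] at h2 ⊢
            omega
        · have hKR : ¬ K ⊆ R := fun h => hwR (h hw)
          simp only [hwR, hKR, if_false] at h2 ⊢; omega
      · rw [hsum', hb.2.2, hff']; simp [hK, hK hw]
  rw [← Set.ncard_image_of_injective (bases f T) (add_left_injective (Pi.single w (1 : ℤ))),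
    himg, ← Set.ncard_union_eq _ ((bases_finite f' T).subset (Set.sep_subset _ _))
      ((bases_finite f' T).subset (Set.sep_subset _ _))]
  · congr 1
    ext b
    simp only [Set.mem_union, Set.mem_ofPred_eq]
    tauto
  · rw [Set.disjoint_left]
    rintro b ⟨_, h⟩ ⟨_, h'⟩
    exact h' h

end Bases

/-! ### Counting bases as a function of the demands -/

section Demand

variable {ι α : Type*} [Fintype ι] [DecidableEq α]

/-- For a family `N` of subsets of `α` and multiplicities `a`, the total multiplicity of the
nonempty members of the family that are contained in `R`. -/
def demand (N : ι → Finset α) (a : ι → ℕ) (R : Finset α) : ℤ :=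
  ∑ v with (N v).Nonempty ∧ N v ⊆ R, (a v : ℤ)

lemma isSupermodular_demand (N : ι → Finset α) (a : ι → ℕ) : IsSupermodular (demand N a) := by
  intro R S
  simp only [demand, Finset.sum_filter, ← Finset.sum_add_distrib]
  refine Finset.sum_le_sum fun v _ => ?_
  have h1 : N v ⊆ R → N v ⊆ R ∪ S := fun h => h.trans Finset.subset_union_left
  have h2 : N v ⊆ S → N v ⊆ R ∪ S := fun h => h.trans Finset.subset_union_right
  simp only [Finset.subset_inter_iff]
  by_cases hn : (N v).Nonempty <;> by_cases hR : N v ⊆ R <;> by_cases hS : N v ⊆ S <;>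
    simp [hn, hR, hS, h1, h2]
  positivity

lemma contract_demand (N : ι → Finset α) (a : ι → ℕ) (S : Finset α) :
    contract (demand N a) S = demand (fun v => N v \ S) a := by
  ext R
  simp only [contract, demand, Finset.sum_filter, ← Finset.sum_sub_distrib]
  refine Finset.sum_congr rfl fun v _ => ?_
  have h1 : (N v \ S).Nonempty ↔ ¬ N v ⊆ S := Finset.sdiff_nonempty
  have h2 : N v \ S ⊆ R ↔ N v ⊆ R ∪ S := by
    rw [Finset.union_comm]; exact sdiff_le_iff
  have h3 : N v ⊆ S → N v ⊆ R ∪ S := fun h => h.trans Finset.subset_union_right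
  have h4 : ¬ N v ⊆ S → (N v).Nonempty := fun h => by
    rw [Finset.nonempty_iff_ne_empty]; rintro h'; exact h (by simp [h'])
  simp only [h1, h2]
  by_cases hS : N v ⊆ S
  · simp [hS, h3 hS]
  · simp [hS, h4 hS]

lemma ncard_bases_demand_zero (N : ι → Finset α) (T : Finset α) :
    (bases (demand N 0) T).ncard = 1 := by
  have h0 : ∀ R, demand N 0 R = 0 := fun R => by simp [demand]
  rw [Set.ncard_eq_one]
  refine ⟨0, Set.eq_singleton_iff_unique_mem.2 ⟨by simp [bases, h0], fun b hb => ?_⟩⟩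
  have hnn : ∀ i ∈ T, 0 ≤ b i := fun i hi => by
    simpa [h0] using hb.2.1 {i} (by simpa using hi)
  have hT := hb.2.2
  rw [h0, Finset.sum_eq_zero_iff_of_nonneg hnn] at hT
  ext i
  by_cases hi : i ∈ T
  · exact hT i hi
  · exact hb.1 i hi

variable [DecidableEq ι]

lemma demand_add_single (N : ι → Finset α) (a : ι → ℕ) (v : ι) (R : Finset α) :
    demand N (a + Pi.single v 1) R =
      demand N a R + if (N v).Nonempty ∧ N v ⊆ R then 1 else 0 := by
  have h : ∀ u, (if (N u).Nonempty ∧ N u ⊆ R then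
      (((a + Pi.single v 1 : ι → ℕ) u : ℕ) : ℤ) else 0) =
      (if (N u).Nonempty ∧ N u ⊆ R then (a u : ℤ) else 0) +
        if u = v then (if (N v).Nonempty ∧ N v ⊆ R then 1 else 0) else 0 := fun u => by
    by_cases huv : u = v
    · subst huv
      by_cases hc : (N u).Nonempty ∧ N u ⊆ R <;> simp [hc]
    · simp [huv]
  simp only [demand, Finset.sum_filter, h, Finset.sum_add_distrib]
  simp

variable [Fintype α]

/-- The bases on `T` with no proper tight subset containing `w` are counted by a polynomial of
degree less than `|T|`, if all bases on nonempty ground sets up to that size are. -/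
lemma degreeLT_ncard_criticalBases {n : ℕ} (h : ∀ (N : ι → Finset α) (T : Finset α), T.Nonempty →
      T.card ≤ n → DegreeLT T.card fun a => ((bases (demand N a) T).ncard : ℤ))
    (N : ι → Finset α) (w : α) : ∀ (k : ℕ) (T : Finset α), T.card = k → w ∈ T → T.card ≤ n →
    DegreeLT T.card fun a => ((criticalBases (demand N a) w T).ncard : ℤ) := by
  intro k
  induction k using Nat.strong_induction_on with
  | _ k ih =>
    intro T hk hw hn
    have key : (fun a => ((criticalBases (demand N a) w T).ncard : ℤ)) =
        (fun a => ((bases (demand N a) T).ncard : ℤ)) -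
          ∑ S ∈ T.powerset.erase T with w ∈ S,
            (fun a => ((criticalBases (demand N a) w S).ncard : ℤ)) *
              fun a => ((bases (demand (fun v => N v \ S) a) (T \ S)).ncard : ℤ) := by
      ext a
      simp only [Pi.sub_apply, Finset.sum_apply, Pi.mul_apply]
      rw [ncard_bases_eq_sum (isSupermodular_demand N a) hw, ← Finset.add_sum_erase _ _
        (show T ∈ {S ∈ T.powerset | w ∈ S} by simp [hw]), ncard_bases_contract_self,
        Finset.filter_erase]
      simp only [contract_demand]
      push_cast
      ring
    rw [key]
    refine (h N T ⟨w, hw⟩ hn).sub (DegreeLT.sum _ _ fun S hS => ?_)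
    simp only [Finset.mem_filter, Finset.mem_erase, Finset.mem_powerset] at hS
    obtain ⟨⟨hne, hST⟩, hwS⟩ := hS
    have hlt := Finset.card_lt_card (hST.ssubset_of_ne hne)
    have hcard := Finset.card_sdiff_add_card_eq_card hST
    have hpos : 0 < S.card := Finset.card_pos.2 ⟨w, hwS⟩
    have h1 := ih S.card (by omega) S rfl hwS (by omega)
    have h2 := h (fun v => N v \ S) (T \ S) (Finset.card_pos.1 (by omega)) (by omega)
    refine (DegreeLT.mul (m := S.card - 1) (n := (T \ S).card - 1) rfl
      (h1.mono (by omega)) (h2.mono (by omega))).mono (by omega)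

/-- The number of bases of `demand N a` on a nonempty ground set `T` is a polynomial function of
`a` of degree less than `|T|`. -/
theorem degreeLT_ncard_bases : ∀ (n : ℕ) (N : ι → Finset α) (T : Finset α), T.Nonempty →
    T.card ≤ n → DegreeLT T.card fun a => ((bases (demand N a) T).ncard : ℤ) := by
  intro n
  induction n with
  | zero => intro N T hT hn; have := Finset.card_pos.2 hT; omega
  | succ n ih =>
    intro N T hT hn
    obtain ⟨k, hk⟩ : ∃ k, T.card = k + 1 := ⟨T.card - 1, by have := Finset.card_pos.2 hT; omega⟩
    rw [hk]
    intro v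
    by_cases hv : (N v).Nonempty ∧ N v ⊆ T
    · obtain ⟨⟨w, hw⟩, hNT⟩ := hv
      have key : fwdDiff (Pi.single v 1) (fun a => ((bases (demand N a) T).ncard : ℤ)) =
          ∑ S ∈ T.powerset with w ∈ S ∧ ¬ N v ⊆ S,
            (fun a => ((criticalBases (demand N (a + Pi.single v 1)) w S).ncard : ℤ)) *
              fun a => ((bases (demand (fun u => N u \ S) (a + Pi.single v 1)) (T \ S)).ncard
                : ℤ) := by
        ext a
        have := ncard_bases_increment (isSupermodular_demand N (a + Pi.single v 1)) hNT hw
          (f := demand N a) fun R => by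
            rw [demand_add_single]
            simp only [show (N v).Nonempty from ⟨w, hw⟩, true_and]
        simp only [fwdDiff, this, contract_demand, Finset.sum_apply, Pi.mul_apply]
        push_cast
        ring
      rw [key]
      refine DegreeLT.sum _ _ fun S hS => ?_
      simp only [Finset.mem_filter, Finset.mem_powerset] at hS
      obtain ⟨hST, hwS, hNS⟩ := hS
      have hlt := Finset.card_lt_card (hST.ssubset_of_ne fun h => hNS (h ▸ hNT))
      have hcard := Finset.card_sdiff_add_card_eq_card hST
      have hpos : 0 < S.card := Finset.card_pos.2 ⟨w, hwS⟩
      have h1 := (degreeLT_ncard_criticalBases ih N w _ S rfl hwS (by omega)).shift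
        (Pi.single v 1)
      have h2 := (ih (fun u => N u \ S) (T \ S) (Finset.card_pos.1 (by omega)) (by omega)).shift
        (Pi.single v 1)
      exact (DegreeLT.mul (m := S.card - 1) (n := (T \ S).card - 1) rfl
        (h1.mono (by omega)) (h2.mono (by omega))).mono (by omega)
    · -- a member of the family that is empty or not contained in `T` has no effect on `T`
      have key : fwdDiff (Pi.single v 1) (fun a => ((bases (demand N a) T).ncard : ℤ)) = 0 := by
        ext a
        have h : ∀ R ⊆ T, demand N (a + Pi.single v 1) R = demand N a R := fun R hR => by
          rw [demand_add_single, if_neg fun h => hv ⟨h.1, h.2.trans hR⟩, add_zero]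
        have : bases (demand N (a + Pi.single v 1)) T = bases (demand N a) T := by
          ext b
          simp only [bases, Set.mem_ofPred_eq, h T subset_rfl]
          refine and_congr_right fun _ => and_congr_left fun _ =>
            forall₂_congr fun R hR => by rw [h R hR]
        simp [fwdDiff, this]
      rw [key]
      exact DegreeLT.zero _

end Demand

/-! ### Lattice points of dilated root polytopes -/

section Ehrhart

/-- A linear inequality that holds on all edge vectors holds, suitably scaled, on the lattice
points of the dilations of the root polytope. -/
lemma mul_le_sum_of_mem_smul_rootPolytope {U : Type*} [Fintype U] (H : SimpleGraph U) {s : ℕ}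
    {z : U → ℤ} (hz : (fun u => (z u : ℝ)) ∈ (s : ℝ) • rootPolytope H) (c : U → ℤ) (k : ℤ)
    (hc : ∀ a b, H.Adj a b → k ≤ c a + c b) : k * s ≤ ∑ u, c u * z u := by
  classical
  obtain ⟨x, hx, hxz⟩ := Set.mem_smul_set.1 hz
  have hconv : Convex ℝ {x : U → ℝ | (k : ℝ) ≤ ∑ u, (c u : ℝ) * x u} := by
    refine convex_halfSpace_ge ⟨fun x y => ?_, fun r x => ?_⟩ _
    · simp [mul_add, Finset.sum_add_distrib]
    · simp only [Pi.smul_apply, smul_eq_mul, Finset.mul_sum]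
      exact Finset.sum_congr rfl fun u _ => by ring
  have hk : (k : ℝ) ≤ ∑ u, (c u : ℝ) * x u := by
    refine convexHull_min ?_ hconv hx
    rintro _ ⟨a, b, hab, rfl⟩
    have := hc a b hab
    simp only [Set.mem_ofPred_eq, Pi.add_apply, mul_add, Finset.sum_add_distrib]
    have hsingle : ∀ a : U, ∑ u, (c u : ℝ) * (Pi.single a (1 : ℝ) : U → ℝ) u = c a := fun a => by
      simp [Pi.single_apply]
    convert (by exact_mod_cast this : (k : ℝ) ≤ (c a : ℝ) + c b) using 2
    · convert hsingle a
    · convert hsingle b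
  have h1 : ∑ u, (c u : ℝ) * (z u : ℝ) = s * ∑ u, (c u : ℝ) * x u := by
    rw [Finset.mul_sum]
    refine Finset.sum_congr rfl fun u _ => ?_
    rw [← congrFun hxz u, Pi.smul_apply, smul_eq_mul]; ring
  have h2 : (k : ℝ) * s ≤ ∑ u, (c u : ℝ) * (z u : ℝ) := by
    rw [h1, mul_comm]
    exact mul_le_mul_of_nonneg_left hk (Nat.cast_nonneg s)
  exact_mod_cast h2

variable {U U' : Type*} [Fintype U] [DecidableEq U]
  {G : SimpleGraph U} {V W A : Finset U} {N : U → Finset U} {ι : U' → U} {s : ℕ}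
  {a : U → ℕ} {b : U → ℤ}

lemma demand_eq_sum (ha : ∀ u, a u ≠ 0 → u ∈ A) (hne : ∀ v ∈ A, (N v).Nonempty) (R : Finset U) :
    demand N a R = ∑ v ∈ A, if N v ⊆ R then (a v : ℤ) else 0 := by
  rw [demand, Finset.sum_filter]
  refine Eq.trans (Finset.sum_subset (Finset.subset_univ A) fun v _ hv => ?_).symm
    (Finset.sum_congr rfl fun v hv => by simp [hne v hv])
  have : a v = 0 := by by_contra h; exact hv (ha v h)
  simp [this]

lemma sum_sigma_fin_ite (c : U → ℕ) (u : U) :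
    ∑ k : (Σ v : U, Fin (c v)), (if k.1 = u then (1 : ℝ) else 0) = c u := by
  rw [Fintype.sum_sigma]
  refine (Finset.sum_congr rfl fun v _ =>
    Finset.sum_const (if v = u then (1 : ℝ) else 0)).trans ?_
  simp

/-- If `b` is a base for the demands `a`, then `(a, b)` is a sum of `|a|` edge vectors, by Hall's
marriage theorem. -/
lemma mem_smul_rootPolytope_of_mem_bases
    (hAV : A ⊆ V) (hG : G.IsBipartiteWith (V : Set U) (W : Set U))
    (hN : ∀ u w, w ∈ N u ↔ G.Adj u w) (hne : ∀ v ∈ V, (N v).Nonempty)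
    (hinj : Function.Injective ι) (hι : ∀ u, u ∈ A ∨ u ∈ W → ∃ x, ι x = u) (hs : s ≠ 0)
    (ha : a ∈ A.piAntidiag s) (hb : b ∈ bases (demand N a) W) :
    (fun x => (((a (ι x) : ℤ) + b (ι x) : ℤ) : ℝ)) ∈ (s : ℝ) • rootPolytope (G.comap ι) := by
  classical
  rw [Finset.mem_piAntidiag] at ha
  obtain ⟨hsum, hsupp⟩ := ha
  have hNW : ∀ v ∈ A, N v ⊆ W := fun v hv w hw => by
    rcases hG.mem_of_adj ((hN v w).1 hw) with h | h
    · exact h.2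
    · exact absurd h.1 (Set.disjoint_left.1 hG.disjoint (hAV hv))
  have hneA : ∀ v ∈ A, (N v).Nonempty := fun v hv => hne v (hAV hv)
  have hbnn : ∀ w, 0 ≤ b w := fun w => by
    by_cases hw : w ∈ W
    · have h := hb.2.1 {w} (by simpa using hw)
      rw [Finset.sum_singleton] at h
      refine le_trans ?_ h
      exact Finset.sum_nonneg fun _ _ => by positivity
    · rw [hb.1 w hw]
  have hmemA : ∀ k : (Σ v : U, Fin (a v)), k.1 ∈ A := fun k =>
    hsupp _ (by have := k.2.2; omega)
  have hmemW : ∀ j : (Σ w : U, Fin (b w).toNat), j.1 ∈ W := fun j => by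
    by_contra h
    have h1 := j.2.2
    have h2 := hb.1 _ h
    omega
  -- Match the units of demand with the units of supply, along edges.
  obtain ⟨φ, hφinj, hφ⟩ := (Finset.all_card_le_biUnion_card_iff_exists_injective
    (fun k : (Σ v : U, Fin (a v)) =>
      (Finset.univ.filter fun j : (Σ w : U, Fin (b w).toNat) => j.1 ∈ N k.1))).1 (by
    intro K
    have hRW : (K.biUnion fun k => N k.1) ⊆ W :=
      Finset.biUnion_subset.2 fun k _ => hNW _ (hmemA k)
    set R := K.biUnion fun k => N k.1 with hR
    have h1 : K ⊆ (Finset.univ.filter fun v => (N v).Nonempty ∧ N v ⊆ R).sigma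
        fun v => (Finset.univ : Finset (Fin (a v))) := fun k hk => by
      simp only [Finset.mem_sigma, Finset.mem_filter, Finset.mem_univ, true_and, and_true]
      exact ⟨hneA _ (hmemA k),
        Finset.subset_biUnion_of_mem (fun k : (Σ v : U, Fin (a v)) => N k.1) hk⟩
    have h2 : R.sigma (fun w => (Finset.univ : Finset (Fin (b w).toNat))) ⊆
        K.biUnion fun k => Finset.univ.filter fun j => j.1 ∈ N k.1 := fun j hj => by
      simpa [hR] using hj
    refine (Finset.card_le_card h1).trans (le_trans ?_ (Finset.card_le_card h2))
    -- Hall's condition for `K` is the base inequality for the neighbourhood `R` of `K`.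
    rw [Finset.card_sigma, Finset.card_sigma]
    simp only [Finset.card_univ, Fintype.card_fin]
    zify
    refine (hb.2.1 R hRW).trans_eq (Finset.sum_congr rfl fun w _ => ?_)
    rw [Int.toNat_of_nonneg (hbnn w)])
  have hcardA : Fintype.card (Σ v : U, Fin (a v)) = s := by
    simp only [Fintype.card_sigma, Fintype.card_fin]
    rw [← hsum]
    exact (Finset.sum_subset (Finset.subset_univ A) fun v _ hv => by
      by_contra h; exact hv (hsupp v h)).symm
  have hcardW : Fintype.card (Σ w : U, Fin (b w).toNat) = s := by
    simp only [Fintype.card_sigma, Fintype.card_fin]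
    zify
    simp only [Int.toNat_of_nonneg (hbnn _)]
    rw [← Finset.sum_subset (Finset.subset_univ W) fun w _ hw => hb.1 w hw, hb.2.2,
      demand_eq_sum hsupp hneA, ← hsum]
    push_cast
    exact Finset.sum_congr rfl fun v hv => by simp [hNW v hv]
  have hbij : Function.Bijective φ :=
    (Fintype.bijective_iff_injective_and_card φ).2 ⟨hφinj, hcardA.trans hcardW.symm⟩
  choose x hx using fun k : (Σ v : U, Fin (a v)) => hι k.1 (Or.inl (hmemA k))
  choose y hy using fun k : (Σ v : U, Fin (a v)) => hι (φ k).1 (Or.inr (hmemW (φ k)))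
  have hs' : (s : ℝ) ≠ 0 := Nat.cast_ne_zero.2 hs
  refine Set.mem_smul_set.2 ⟨∑ k : (Σ v : U, Fin (a v)),
    (s : ℝ)⁻¹ • (Pi.single (x k) 1 + Pi.single (y k) 1 : U' → ℝ), ?_, ?_⟩
  · refine (convex_convexHull ℝ _).sum_mem (fun _ _ => by positivity) ?_ fun k _ =>
      subset_convexHull ℝ _ ⟨x k, y k, ?_, by congr!⟩
    · rw [Finset.sum_const, Finset.card_univ, hcardA, nsmul_eq_mul, mul_inv_cancel₀ hs']
    · rw [SimpleGraph.comap_adj, hx, hy, ← hN]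
      simpa using hφ k
  · rw [← Finset.smul_sum, smul_inv_smul₀ hs']
    ext u
    have e1 : ∑ k, (Pi.single (x k) (1 : ℝ) : U' → ℝ) u = a (ι u) := by
      have : ∀ k, (Pi.single (x k) (1 : ℝ) : U' → ℝ) u = if k.1 = ι u then 1 else 0 := fun k => by
        simp only [Pi.single_apply, ← hx k, hinj.eq_iff, eq_comm]
      simp only [this, sum_sigma_fin_ite]
    have e2 : ∑ k, (Pi.single (y k) (1 : ℝ) : U' → ℝ) u = b (ι u) := by
      have : ∀ k, (Pi.single (y k) (1 : ℝ) : U' → ℝ) u =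
          if (φ k).1 = ι u then 1 else 0 := fun k => by
        simp only [Pi.single_apply, ← hy k, hinj.eq_iff, eq_comm]
      simp only [this]
      rw [hbij.sum_comp (fun j => if j.1 = ι u then (1 : ℝ) else 0), sum_sigma_fin_ite]
      have h3 : (((b (ι u)).toNat : ℤ) : ℝ) = b (ι u) := by rw [Int.toNat_of_nonneg (hbnn _)]
      exact_mod_cast h3
    simp only [Finset.sum_apply, Pi.add_apply, Finset.sum_add_distrib, e1, e2]
    push_cast
    rfl

/-- The lattice points of a dilated root polytope split into demands `a` and a base for `a`. -/
lemma exists_mem_bases_of_mem_smul_rootPolytope [Fintype U']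
    (hAV : A ⊆ V) (hG : G.IsBipartiteWith (V : Set U) (W : Set U))
    (hN : ∀ u w, w ∈ N u ↔ G.Adj u w) (hne : ∀ v ∈ V, (N v).Nonempty)
    (hinj : Function.Injective ι) (hι : ∀ u, u ∈ A ∨ u ∈ W ↔ ∃ x, ι x = u) {z : U' → ℤ}
    (hz : (fun x => (z x : ℝ)) ∈ (s : ℝ) • rootPolytope (G.comap ι)) :
    ∃ a ∈ A.piAntidiag s, ∃ b ∈ bases (demand N a) W,
      (fun x => (a (ι x) : ℤ) + b (ι x)) = z := by
  classical
  have hdisj : ∀ u ∈ A, u ∉ W := fun u hu => Set.disjoint_left.1 hG.disjoint (hAV hu)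
  set y : U → ℤ := Function.extend ι z 0 with hy
  have hyι : ∀ x, y (ι x) = z x := fun x => hinj.extend_apply z 0 x
  have hynn : ∀ u, 0 ≤ y u := fun u => by
    by_cases hu : ∃ x, ι x = u
    · obtain ⟨x, rfl⟩ := hu
      rw [hyι]
      have := mul_le_sum_of_mem_smul_rootPolytope _ hz (Pi.single x 1) 0 fun p q _ => by
        simp only [Pi.single_apply]; split_ifs <;> simp
      simpa [Pi.single_apply] using this
    · rw [hy, Function.extend_apply' _ _ _ hu, Pi.zero_apply]
  have key : ∀ (c : U → ℤ) (k : ℤ), (∀ p ∈ A, ∀ q ∈ W, G.Adj p q → k ≤ c p + c q) →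
      k * s ≤ ∑ u ∈ A, c u * y u + ∑ u ∈ W, c u * y u := fun c k hc => by
    refine (mul_le_sum_of_mem_smul_rootPolytope _ hz (fun x => c (ι x)) k
      fun p q hpq => ?_).trans_eq ?_
    · rw [SimpleGraph.comap_adj] at hpq
      have hp := (hι (ι p)).2 ⟨p, rfl⟩
      have hq := (hι (ι q)).2 ⟨q, rfl⟩
      have hVW := Set.disjoint_left.1 hG.disjoint
      rcases hG.mem_of_adj hpq with h | h
      · exact hc _ (hp.resolve_right (hVW h.1)) _ h.2 hpq
      · rw [add_comm]
        exact hc _ (hq.resolve_right (hVW h.2)) _ h.1 hpq.symm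
    · rw [← Finset.sum_union (Finset.disjoint_left.2 hdisj)]
      have : A ∪ W = Finset.univ.image ι := by ext u; simp [hι]
      rw [this, Finset.sum_image fun p _ q _ h => hinj h]
      exact Finset.sum_congr rfl fun x _ => by rw [hyι]
  have hA1 : ∀ u ∈ W, u ∉ A := fun u hu hu' => hdisj u hu' hu
  have hsumA : ∑ u ∈ A, y u = s := by
    have hone : ∀ r : ℤ, ∑ u ∈ A, (if u ∈ A then r else 0) * y u +
        ∑ u ∈ W, (if u ∈ A then r else 0) * y u = r * ∑ u ∈ A, y u := fun r => by
      rw [Finset.sum_eq_zero (s := W) fun u hu => by simp [hA1 u hu], add_zero, Finset.mul_sum]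
      exact Finset.sum_congr rfl fun u hu => by simp [hu]
    have h1 := key (fun u => if u ∈ A then 1 else 0) 1 fun p hp q hq _ => by
      simp [hp, hA1 q hq]
    have h2 := key (fun u => if u ∈ A then -1 else 0) (-1) fun p hp q hq _ => by
      simp [hp, hA1 q hq]
    rw [hone] at h1 h2
    omega
  have hsumW : ∑ u ∈ W, y u = s := by
    have hone : ∀ r : ℤ, ∑ u ∈ A, (if u ∈ W then r else 0) * y u +
        ∑ u ∈ W, (if u ∈ W then r else 0) * y u = r * ∑ u ∈ W, y u := fun r => by
      rw [Finset.sum_eq_zero (s := A) fun u hu => by simp [hdisj u hu], zero_add, Finset.mul_sum]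
      exact Finset.sum_congr rfl fun u hu => by simp [hu]
    have h1 := key (fun u => if u ∈ W then 1 else 0) 1 fun p hp q hq _ => by
      simp [hq, hdisj p hp]
    have h2 := key (fun u => if u ∈ W then -1 else 0) (-1) fun p hp q hq _ => by
      simp [hq, hdisj p hp]
    rw [hone] at h1 h2
    omega
  -- An edge at a vertex of `A` whose neighbours all lie in `R` ends in `R`, so the weight that is `1`
  -- on `R` and `-1` on such vertices is nonnegative on every edge.
  have hcut : ∀ R ⊆ W, ∑ u ∈ A, (if N u ⊆ R then y u else 0) ≤ ∑ u ∈ R, y u := fun R hR => by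
    have h1 := key (fun u => (if u ∈ R then 1 else 0) - if u ∈ A ∧ N u ⊆ R then 1 else 0) 0
      fun p hp q hq hpq => by
        have hpR : p ∉ R := fun h => hdisj p hp (hR h)
        have hqR : N p ⊆ R → q ∈ R := fun h => h ((hN p q).2 hpq)
        by_cases h : N p ⊆ R
        · simp [hpR, hp, hA1 q hq, h, hqR h]
        · simp only [hpR, hp, hA1 q hq, h, if_false, false_and, and_false]
          split_ifs <;> simp
    have e1 : ∑ u ∈ A, ((if u ∈ R then 1 else 0) - if u ∈ A ∧ N u ⊆ R then 1 else 0) * y u =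
        -∑ u ∈ A, (if N u ⊆ R then y u else 0) := by
      rw [← Finset.sum_neg_distrib]
      refine Finset.sum_congr rfl fun u hu => ?_
      have huR : u ∉ R := fun h => hdisj u hu (hR h)
      simp [huR, hu]
    have e2 : ∑ u ∈ W, ((if u ∈ R then 1 else 0) - if u ∈ A ∧ N u ⊆ R then 1 else 0) * y u =
        ∑ u ∈ R, y u := by
      rw [← Finset.sum_subset hR fun u hu hu' => by simp [hu', hA1 u hu]]
      exact Finset.sum_congr rfl fun u hu => by simp [hu, hA1 u (hR hu)]
    rw [e1, e2] at h1
    omega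
  set a : U → ℕ := fun u => if u ∈ A then (y u).toNat else 0 with ha
  have haA : ∀ u ∈ A, (a u : ℤ) = y u := fun u hu => by
    simp [ha, hu, hynn u]
  have hsupp : ∀ u, a u ≠ 0 → u ∈ A := fun u hu => by
    by_contra h; simp [ha, h] at hu
  have hneA : ∀ v ∈ A, (N v).Nonempty := fun v hv => hne v (hAV hv)
  have hdem : ∀ R, demand N a R = ∑ u ∈ A, if N u ⊆ R then y u else 0 := fun R => by
    rw [demand_eq_sum hsupp hneA]
    exact Finset.sum_congr rfl fun u hu => by rw [haA u hu]
  have hbW : ∀ R ⊆ W, ∑ u ∈ R, (if u ∈ W then y u else 0) = ∑ u ∈ R, y u := fun R hR =>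
    Finset.sum_congr rfl fun u hu => by simp [hR hu]
  refine ⟨a, Finset.mem_piAntidiag.2 ⟨?_, hsupp⟩, fun u => if u ∈ W then y u else 0,
    ⟨fun u hu => by simp [hu], fun R hR => ?_, ?_⟩, ?_⟩
  · change ∑ u ∈ A, a u = s
    zify
    rw [← hsumA]
    exact Finset.sum_congr rfl haA
  · rw [hdem, hbW R hR]; exact hcut R hR
  · rw [hdem, hbW W subset_rfl, hsumW, ← hsumA]
    refine Finset.sum_congr rfl fun u hu => ?_
    rw [if_pos]
    intro w hw
    rcases hG.mem_of_adj ((hN u w).1 hw) with h | h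
    · exact h.2
    · exact absurd h.1 (hdisj u hu)
  · ext x
    rw [← hyι x]
    rcases (hι (ι x)).2 ⟨x, rfl⟩ with h | h
    · simp [haA _ h, hdisj _ h]
    · simp [ha, hA1 _ h, h]

/-- The lattice points of the dilated root polytope of the subgraph induced on `A ∪ W` (the range
of `ι`, with `A ⊆ V`), grouped by their `A`-coordinates `a`. -/
lemma ehrhartCount_comap [Fintype U']
    (hAV : A ⊆ V) (hG : G.IsBipartiteWith (V : Set U) (W : Set U))
    (hN : ∀ u w, w ∈ N u ↔ G.Adj u w) (hne : ∀ v ∈ V, (N v).Nonempty)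
    (hinj : Function.Injective ι) (hι : ∀ u, u ∈ A ∨ u ∈ W ↔ ∃ x, ι x = u) (hs : s ≠ 0) :
    ehrhartCount (G.comap ι) s =
      ∑ a ∈ A.piAntidiag s, (bases (demand N a) W).ncard := by
  classical
  have hset : {z : U' → ℤ | (fun x => (z x : ℝ)) ∈ (s : ℝ) • rootPolytope (G.comap ι)} =
      (((A.piAntidiag s).sigma fun a => (bases_finite (demand N a) W).toFinset).image
        fun c => fun x => (c.1 (ι x) : ℤ) + c.2 (ι x) : Finset (U' → ℤ)) := by
    ext z
    simp only [Finset.coe_image, Set.mem_image, Finset.mem_coe, Finset.mem_sigma,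
      Set.Finite.mem_toFinset, Set.mem_ofPred_eq, Sigma.exists]
    constructor
    · intro hz
      obtain ⟨a, ha, b, hb, h⟩ :=
        exists_mem_bases_of_mem_smul_rootPolytope hAV hG hN hne hinj hι hz
      exact ⟨a, b, ⟨ha, hb⟩, h⟩
    · rintro ⟨a, b, ⟨ha, hb⟩, rfl⟩
      exact mem_smul_rootPolytope_of_mem_bases hAV hG hN hne hinj (fun u => (hι u).1) hs ha hb
  rw [ehrhartCount, hset, Set.ncard_coe_finset, Finset.card_image_of_injOn, Finset.card_sigma]
  · exact Finset.sum_congr rfl fun a _ =>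
      (Set.ncard_eq_toFinset_card _ (bases_finite (demand N a) W)).symm
  · rintro ⟨a, b⟩ h ⟨a', b'⟩ h' heq
    simp only [Finset.mem_coe, Finset.mem_sigma, Finset.mem_piAntidiag,
      Set.Finite.mem_toFinset] at h h'
    have hval : ∀ u, u ∈ A ∨ u ∈ W → (a u : ℤ) + b u = a' u + b' u := fun u hu => by
      obtain ⟨x, rfl⟩ := (hι u).1 hu
      exact congrFun heq x
    have hdisj : ∀ u ∈ A, u ∉ W := fun u hu => Set.disjoint_left.1 hG.disjoint (hAV hu)
    have hpt : ∀ u, a u = a' u ∧ b u = b' u := fun u => by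
      have hA0 : u ∉ A → a u = 0 ∧ a' u = 0 := fun hu =>
        ⟨by by_contra h0; exact hu (h.1.2 u h0), by by_contra h0; exact hu (h'.1.2 u h0)⟩
      have hW0 : u ∉ W → b u = 0 ∧ b' u = 0 := fun hu => ⟨h.2.1 u hu, h'.2.1 u hu⟩
      have h1 := hval u
      have h2 := hdisj u
      by_cases huA : u ∈ A <;> by_cases huW : u ∈ W <;> simp only [huA, huW, not_true_eq_false,
        not_false_eq_true, true_or, or_true, or_self, forall_const, imp_false, IsEmpty.forall_iff]
        at hA0 hW0 h1 h2 <;> omega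
    obtain rfl : a = a' := funext fun u => (hpt u).1
    obtain rfl : b = b' := funext fun u => (hpt u).2
    rfl

/-- The same function of `a` serves for all induced subgraphs on `A ∪ W`: deleting vertices of `V`
restricts it to a face of the orthant `ℕ^V`. The series has constant term `1` by definition, which
agrees with the single base for zero demands. -/
lemma ehrhartSeries_comap [Fintype U']
    (hAV : A ⊆ V) (hG : G.IsBipartiteWith (V : Set U) (W : Set U))
    (hN : ∀ u w, w ∈ N u ↔ G.Adj u w) (hne : ∀ v ∈ V, (N v).Nonempty)
    (hinj : Function.Injective ι) (hι : ∀ u, u ∈ A ∨ u ∈ W ↔ ∃ x, ι x = u) :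
    ehrhartSeries (G.comap ι) = genFun A fun a => ((bases (demand N a) W).ncard : ℤ) := by
  ext s
  rw [ehrhartSeries, genFun, PowerSeries.coeff_mk, PowerSeries.coeff_mk]
  rcases eq_or_ne s 0 with rfl | hs
  · simp [ncard_bases_demand_zero]
  · rw [if_neg hs, ehrhartCount_comap hAV hG hN hne hinj hι hs]
    push_cast
    rfl

end Ehrhart

/-! ### The recursion for interior polynomials -/

lemma isInteriorPolynomial_interiorPolynomial {U : Type*} {G : SimpleGraph U}
    (h : ∃ P : ℤ[X], IsInteriorPolynomial G P) :
    IsInteriorPolynomial G (interiorPolynomial G) := by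
  rw [interiorPolynomial, dif_pos h]
  exact h.choose_spec

theorem mainTheorem2 {U : Type*} [Fintype U] [DecidableEq U] (G : SimpleGraph U)
    (V W : Finset U) (hVW : V ∪ W = Finset.univ)
    (hG : G.IsBipartiteWith (V : Set U) (W : Set U))
    (hV : V.Nonempty) (hnbr : ∀ v ∈ V, ∃ w, G.Adj v w)
    (hcard : W.card ≤ V.card) :
    IsInteriorPolynomial G (interiorPolynomial G) ∧
    (∀ J ⊆ V, IsInteriorPolynomial (deleteVertices G J)
      (interiorPolynomial (deleteVertices G J))) ∧
    interiorPolynomial G =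
      ∑ J ∈ V.powerset.filter (fun J => J.Nonempty),
        (-1) ^ (J.card - 1) * interiorPolynomial (deleteVertices G J) := by
  classical
  have hdisj : Disjoint V W := Finset.disjoint_coe.1 hG.disjoint
  have huniv : ∀ u, u ∈ V ∨ u ∈ W := fun u => by
    rw [← Finset.mem_union, hVW]; exact Finset.mem_univ u
  have hcardU : Nat.card U = V.card + W.card := by
    rw [Nat.card_eq_fintype_card, ← Finset.card_univ, ← hVW, Finset.card_union_of_disjoint hdisj]
  have hW : W.Nonempty := by
    obtain ⟨v, hv⟩ := hV
    obtain ⟨w, hw⟩ := hnbr v hv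
    rcases hG.mem_of_adj hw with h | h
    · exact ⟨w, h.2⟩
    · exact ⟨v, h.1⟩
  have hWpos := Finset.card_pos.2 hW
  set N : U → Finset U := fun u => {w | G.Adj u w} with hNdef
  have hN : ∀ u w, w ∈ N u ↔ G.Adj u w := fun u w => by simp [hNdef]
  have hne : ∀ v ∈ V, (N v).Nonempty := fun v hv => by
    obtain ⟨w, hw⟩ := hnbr v hv
    exact ⟨w, (hN v w).2 hw⟩
  set p : (U → ℕ) → ℤ := fun a => ((bases (demand N a) W).ncard : ℤ) with hp
  have hdeg : DegreeLT W.card p := degreeLT_ncard_bases W.card N W hW le_rfl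
  have hpoly : ∀ A : Finset U, ∃ P : ℤ[X],
      (P : ℤ⟦X⟧) = (1 - PowerSeries.X) ^ (A.card + (W.card - 1)) * genFun A p := fun A =>
    exists_polynomial_eq_genFun _ _ A p rfl (hdeg.mono (by omega))
  have hserG : ehrhartSeries G = genFun V p := by
    have := ehrhartSeries_comap (ι := id) subset_rfl hG hN hne Function.injective_id
      (fun u => by simp [huniv u])
    rwa [SimpleGraph.comap_id] at this
  have hserJ : ∀ J ⊆ V, ehrhartSeries (deleteVertices G J) = genFun (V \ J) p := fun J hJ =>
    ehrhartSeries_comap (G := G) (U' := ((J : Set U)ᶜ : Set U)) (ι := Subtype.val)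
      Finset.sdiff_subset hG hN hne Subtype.val_injective fun u => by
        have h1 := huniv u
        have h2 : u ∈ W → u ∉ J := fun hw hj => Finset.disjoint_left.1 hdisj (hJ hj) hw
        simp only [Finset.mem_sdiff, Subtype.exists, Set.mem_compl_iff, Finset.mem_coe,
          exists_prop, exists_eq_right]
        tauto
  have hcardJ : ∀ J ⊆ V, Nat.card ((J : Set U)ᶜ : Set U) - 1 =
      (V \ J).card + (W.card - 1) := fun J hJ => by
    have h1 := Set.ncard_add_ncard_compl (J : Set U)
    rw [Set.ncard_coe_finset, hcardU, ← Nat.card_coe_set_eq (J : Set U)ᶜ] at h1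
    have h2 := Finset.card_sdiff_add_card_eq_card hJ
    omega
  have hIG : IsInteriorPolynomial G (interiorPolynomial G) := by
    refine isInteriorPolynomial_interiorPolynomial ?_
    obtain ⟨P, hP⟩ := hpoly V
    refine ⟨P, ?_⟩
    rw [IsInteriorPolynomial, hserG, hP, hcardU, Nat.add_sub_assoc hWpos]
  have hIJ : ∀ J ⊆ V, IsInteriorPolynomial (deleteVertices G J)
      (interiorPolynomial (deleteVertices G J)) := fun J hJ => by
    refine isInteriorPolynomial_interiorPolynomial ?_
    obtain ⟨P, hP⟩ := hpoly (V \ J)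
    refine ⟨P, ?_⟩
    rw [IsInteriorPolynomial, hserJ J hJ, hP, hcardJ J hJ]
  refine ⟨hIG, hIJ, ?_⟩
  have halt := alternating_sum_genFun_eq_zero V p (hdeg.mono hcard)
  -- Separate the term `J = ∅`, which is the interior polynomial of `G` itself.
  have hsplit : V.powerset = insert ∅ (V.powerset.filter fun J => J.Nonempty) := by
    ext J
    rcases J.eq_empty_or_nonempty with rfl | h
    · simp
    · simp [h, h.ne_empty]
  rw [hsplit, Finset.sum_insert (by simp)] at halt
  rw [← Polynomial.coe_inj, hIG, hserG, hcardU, Nat.add_sub_assoc hWpos,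
    ← Polynomial.coeToPowerSeries.ringHom_apply, map_sum]
  have hterm : ∀ J ∈ V.powerset.filter fun J => J.Nonempty,
      Polynomial.coeToPowerSeries.ringHom
        ((-1) ^ (J.card - 1) * interiorPolynomial (deleteVertices G J)) =
      -((1 - PowerSeries.X) ^ (W.card - 1) * ((-1) ^ J.card *
        (1 - PowerSeries.X) ^ (V.card - J.card) * genFun (V \ J) p)) := fun J hJ => by
    simp only [Finset.mem_filter, Finset.mem_powerset] at hJ
    obtain ⟨k, hk⟩ : ∃ k, J.card = k + 1 :=
      ⟨J.card - 1, by have := Finset.card_pos.2 hJ.2; omega⟩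
    rw [map_mul, map_pow, map_neg, map_one, Polynomial.coeToPowerSeries.ringHom_apply,
      hIJ J hJ.1, hserJ J hJ.1, hcardJ J hJ.1, Finset.card_sdiff_of_subset hJ.1, hk,
      Nat.add_sub_cancel]
    ring
  rw [Finset.sum_congr rfl hterm, Finset.sum_neg_distrib, ← Finset.mul_sum]
  simp only [Finset.card_empty, pow_zero, one_mul, Nat.sub_zero, Finset.sdiff_empty] at halt
  linear_combination (1 - PowerSeries.X) ^ (W.card - 1) * halt
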